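/- **Theorem (Stability of maximal elements).** For $N=2^n$ let $\star_n$ be the Laver operation on $\{1,\dots,N\}$, i.e. the unique binary operation with $p\star_n 1=p+1$ for $p<N$, $N\star_n 1=1$, and $p\star_n(q+1)=(p\star_n q)\star_n(p\star_n 1)$ for all $1\le p\le N$ and $1\le q<N$. For nonnegative integers $p,q$ put $$p*q:=N-(N-p)\star_n(N-q),\qquad N=2^n>\max(p,q);$$ this value does not depend on the choice of such an $n$ (to fix ideas, take the smallest one). For positive integers $p,q$ put $p\circ q:=p*(q-1)+1$. For a positive integer $p$ let $\pi(p)$ be the least positive period of the sequence $p*0,\,p*1,\,p*2,\dots$, and let $\mathrm{bit}(m)$ be the number of ones in the binary expansion of $m$. A positive integer $p$ is called *maximal* if $\pi(p)=2^{\mathrm{bit}(p-1)}$. Let $\mathcal M$ be the set of maximal integers and $\mathcal M^*=\mathcal M\cup\{0\}$. Then: 1. if $p,q\in\mathcal M^*$, then $p*q\in\mathcal M^*$; 2. if $p,q\in\mathcal M$, then $p\circ q\in\mathcal M$. -/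

import Mathlib

namespace Laver

/-- The operation `p ⋆ q` on `{1, …, N}`: the operation with `p ⋆ 1 = p + 1` (taken modulo `N`, with
values in `{1, …, N}`) and `p ⋆ (q + 1) = (p ⋆ q) ⋆ (p + 1)`, computed by descending recursion on
`p` and ascending recursion on `q`. The row of `N` is `N ⋆ q = q`. Only arguments in `{1, …, N}`
matter. The test `p < p ⋆ (q + 1)` makes the recursion visibly well-founded and always succeeds
for `p < N` (see `lt_star`). -/
def star (N p q : ℕ) : ℕ :=
  if _hp : N ≤ p then q
  else
    match q with
    | 0 => N
    | 1 => p + 1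
    | q + 2 =>
      if h : p < star N p (q + 1) then star N (star N p (q + 1)) (p + 1) else N
termination_by (N - p, q)
decreasing_by
  · exact Prod.Lex.right _ (by omega)
  · exact Prod.Lex.left _ _ (by omega)

theorem star_self (N q : ℕ) : star N N q = q := by
  rw [star.eq_def]; simp

theorem star_one {N p : ℕ} (hp : p < N) : star N p 1 = p + 1 := by
  rw [star]; simp [hp]

/-- For `p < N` one has `p < p ⋆ q ≤ N`. -/
theorem lt_star {N p : ℕ} (hp : p < N) (q : ℕ) : p < star N p q ∧ star N p q ≤ N := by
  induction hk : N - p using Nat.strong_induction_on generalizing p q with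
  | _ k ih =>
    have key : ∀ q, p < star N p q ∧ star N p q ≤ N := by
      intro q
      induction q with
      | zero => rw [star]; simp [not_le.mpr hp, hp]
      | succ q ihq =>
        rcases q with _ | q
        · rw [star_one hp]; omega
        · rw [star]
          simp only [not_le.mpr hp, dite_false, ihq.1, dite_true]
          rcases ihq.2.lt_or_eq with h | h
          · have := ih (N - star N p (q + 1)) (by omega) h (p + 1) rfl
            omega
          · rw [h, star_self]; omega
    exact key q

/-- The defining relation `p ⋆ (q + 1) = (p ⋆ q) ⋆ (p + 1)`. -/
theorem star_succ {N p q : ℕ} (hp : p < N) (hq : 1 ≤ q) :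
    star N p (q + 1) = star N (star N p q) (p + 1) := by
  obtain ⟨q, rfl⟩ : ∃ r, q = r + 1 := ⟨q - 1, by omega⟩
  conv_lhs => rw [star]
  simp [not_le.mpr hp, (lt_star hp (q + 1)).1]

/-- `star N` takes values in `{1, …, N}` and satisfies the two identities that define it:
`p ⋆ 1 = p + 1` modulo `N`, and `p ⋆ (q ⋆ 1) = (p ⋆ q) ⋆ (p ⋆ 1)`. -/
theorem star_spec {N p : ℕ} (hp : 1 ≤ p) (hpN : p ≤ N) :
    star N p 1 = p % N + 1 ∧ ∀ q, 1 ≤ q → q < N →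
      (1 ≤ star N p q ∧ star N p q ≤ N) ∧
      star N p (star N q 1) = star N (star N p q) (star N p 1) := by
  rcases hpN.lt_or_eq with h | rfl
  · refine ⟨by rw [star_one h, Nat.mod_eq_of_lt h], fun q hq hqN => ⟨?_, ?_⟩⟩
    · have := lt_star h q; omega
    · rw [star_one hqN, star_one h, star_succ h hq]
  · refine ⟨by simp [star_self], fun q hq hqN => ⟨?_, ?_⟩⟩
    · rw [star_self]; omega
    · simp [star_self]

/-- Any operation on `{1, …, N}` with these two identities agrees with `star N`. -/
theorem star_unique {N : ℕ} (f : ℕ → ℕ → ℕ)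
    (h1 : ∀ p, 1 ≤ p → p ≤ N → f p 1 = p % N + 1)
    (h2 : ∀ p q, 1 ≤ p → p ≤ N → 1 ≤ q → q < N → f p (f q 1) = f (f p q) (f p 1))
    {p q : ℕ} (hp : 1 ≤ p) (hpN : p ≤ N) (hq : 1 ≤ q) (hqN : q ≤ N) :
    f p q = star N p q := by
  have hs : ∀ q, 1 ≤ q → q < N → f q 1 = q + 1 := fun q hq hqN => by
    rw [h1 q hq hqN.le, Nat.mod_eq_of_lt hqN]
  have hN : ∀ q, 1 ≤ q → q ≤ N → f N q = q := by
    intro q hq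
    induction q, hq using Nat.le_induction with
    | base => intro _; rw [h1 N (by omega) le_rfl]; simp
    | succ q hq ih =>
      intro hqN
      have := h2 N q (by omega) le_rfl hq (by omega)
      rw [hs q hq (by omega), ih (by omega), h1 N (by omega) le_rfl] at this
      simpa [hs q hq (by omega)] using this
  induction hk : N - p using Nat.strong_induction_on generalizing p q with
  | _ k ih =>
    rcases hpN.lt_or_eq with hlt | rfl
    · induction q, hq using Nat.le_induction with
      | base => rw [hs p hp hlt, star_one hlt]
      | succ q hq ihq =>
        have := h2 p q hp hpN hq (by omega)
        rw [hs q hq (by omega), hs p hp hlt, ihq (by omega)] at this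
        have hb := lt_star hlt q
        rw [this, star_succ hlt hq]
        exact ih (N - star N p q) (by omega) (by omega) hb.2 (by omega) (by omega) rfl
    · rw [hN q hq hqN, star_self]

/-- The operation `p * q = N - (N - p) ⋆ (N - q)` on the nonnegative integers, where `N = 2 ^ n` is
a power of two with `p, q < N`. The value does not depend on the choice of such an `n`; here `n` is
the smallest one. -/
def op (p q : ℕ) : ℕ :=
  2 ^ (max p q).size -
    star (2 ^ (max p q).size) (2 ^ (max p q).size - p) (2 ^ (max p q).size - q)

/-- The operation `p ∘ q = p * (q - 1) + 1` on the positive integers. -/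
def comp (p q : ℕ) : ℕ := op p (q - 1) + 1

/-- The period `π(p)` of the sequence `p * 0, p * 1, p * 2, …`: its least positive period. -/
noncomputable def period (p : ℕ) : ℕ :=
  sInf {t : ℕ | 0 < t ∧ Function.Periodic (op p) t}

/-- The number of ones in the binary expansion of `n`. -/
def bit (n : ℕ) : ℕ := (Nat.digits 2 n).count 1

/-- A positive integer `p` is maximal if `π(p) = 2 ^ bit(p - 1)`. -/
def IsMaximal (p : ℕ) : Prop := 0 < p ∧ period p = 2 ^ bit (p - 1)

/-- The set `M` of maximal elements. -/
def maximalSet : Set ℕ := {p | IsMaximal p}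

/-- The set `M* = M ∪ {0}`. -/
def maximalSetStar : Set ℕ := maximalSet ∪ {0}

end Laver

namespace Laver

open Function

/-! The recursion gives p * q = (p * (q + 1)) * (p - 1), so the row of p > 0 read backwards is the
orbit of 0 under x ↦ x * (p - 1), and π(p) is the period of that orbit. Reduction modulo 2^n is a
homomorphism. Hence for 0 < p ≤ 2^n the orbit for 2^n + p lifts the orbit for p: its period is the
same or doubles, and if it doubles the new row is the old row followed by the old row shifted by 2^n
(`orbitPeriod_two_pow_add`).

Thus each binary digit of p - 1 at most doubles the period, and p is maximal iff every digit does.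
For maximal p, the row then sends sums of distinct 2^a with a < bit(p - 1) to the sums of the 2^(P
a), with P strictly increasing (`IsMaximal.exists_row`).

For p ∘ q, left distributivity gives (p ∘ q) * r = p * (q * r). After truncating q - 1 to the digits
that p sees, the rows of p ∘ q and q have the same zeros, and bit(p * (q - 1)) = bit(q - 1). For p *
q, digits are added to q - 1 one at a time. Left distributivity, evaluated where the row of q first
reaches its new power of two, shows that the period of p * q doubles as well. -/

/-- An iterate of a map that decreases positive numbers stays below `p` if `f 0 < p`. -/
theorem iterate_zero_lt {f : ℕ → ℕ} {p : ℕ} (h0 : f 0 < p) (hf : ∀ x, 0 < x → x < p → f x < x)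
    (i : ℕ) : f^[i] 0 < p := by
  induction i with
  | zero => simp only [iterate_zero, id]; omega
  | succ i ih =>
    rw [iterate_succ_apply']
    rcases Nat.eq_zero_or_pos (f^[i] 0) with h | h
    · rwa [h]
    · exact (hf _ h ih).trans ih

/-- The orbit of `0` under a lift `F` of `f` modulo `N` has the same period as that of `f`, or twice
this period; in the latter case it is determined by the orbit under `f`. -/
theorem minimalPeriod_lift {F f : ℕ → ℕ} {N : ℕ} (hN : 0 < N)
    (hm : 0 < minimalPeriod f 0) (hmod : ∀ i, F^[i] 0 % N = f^[i] 0)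
    (hFN : F N = f 0) (hlow : ∀ x, 0 < x → x < N → F x = f x)
    (hdec : ∀ x, 0 < x → x < 2 * N → F x < x) (hF0 : F 0 < 2 * N) :
    (F^[minimalPeriod f 0] 0 = 0 ∧ minimalPeriod F 0 = minimalPeriod f 0) ∨
    (F^[minimalPeriod f 0] 0 = N ∧ minimalPeriod F 0 = 2 * minimalPeriod f 0 ∧
      (∀ i, 0 < i → i ≤ minimalPeriod f 0 → F^[i] 0 = N + f^[i] 0) ∧
      ∀ i, 0 < i → i ≤ minimalPeriod f 0 → F^[minimalPeriod f 0 + i] 0 = f^[i] 0) := by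
  set m := minimalPeriod f 0 with hmdef
  have hlt : ∀ i, F^[i] 0 < 2 * N := iterate_zero_lt hF0 hdec
  have hfm : f^[m] 0 = 0 := iterate_minimalPeriod
  have hne : ∀ i, 0 < i → i < m → f^[i] 0 ≠ 0 := fun i h0 h1 h =>
    not_isPeriodicPt_of_pos_of_lt_minimalPeriod h0.ne' h1 h
  have hdvd : m ∣ minimalPeriod F 0 := by
    refine IsPeriodicPt.minimalPeriod_dvd ?_
    have := hmod (minimalPeriod F 0)
    rw [iterate_minimalPeriod, Nat.zero_mod] at this
    exact this.symm
  have h0N : F^[m] 0 = 0 ∨ F^[m] 0 = N := by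
    have h1 := hmod m
    have h2 := hlt m
    rw [hfm] at h1
    obtain ⟨c, hc⟩ := Nat.dvd_of_mod_eq_zero h1
    rw [hc] at h2 ⊢
    have : c < 2 := by
      by_contra h
      nlinarith
    interval_cases c <;> simp
  rcases h0N with h | h
  · exact .inl ⟨h, Nat.dvd_antisymm (IsPeriodicPt.minimalPeriod_dvd h) hdvd⟩
  -- Second lap: from N the map F goes to f 0, and then stays among nonzero values below N, where F
  -- = f.
  · have hsnd : ∀ i, 0 < i → i ≤ m → F^[m + i] 0 = f^[i] 0 := by
      intro i hi
      induction i, hi using Nat.le_induction with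
      | base => intro _; rw [iterate_succ_apply', h, hFN]; rfl
      | succ i hi ih =>
        intro him
        rw [← add_assoc, iterate_succ_apply', ih (by omega), iterate_succ_apply']
        refine hlow _ (Nat.pos_of_ne_zero (hne i hi him)) ?_
        rw [← hmod]; exact Nat.mod_lt _ hN
    have h2m : F^[2 * m] 0 = 0 := by rw [two_mul, hsnd m hm le_rfl, hfm]
    -- First lap, backwards from time m: F decreases positive values, so every earlier nonzero value
    -- is at least the final value N.
    have hfst : ∀ j, j < m → N ≤ F^[m - j] 0 := by
      intro j
      induction j with
      | zero => intro _; rw [Nat.sub_zero, h]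
      | succ j ih =>
        intro hj
        have h1 := ih (by omega)
        rw [show m - j = (m - (j + 1)) + 1 by omega, iterate_succ_apply'] at h1
        have hpos : 0 < F^[m - (j + 1)] 0 := by
          refine Nat.pos_of_ne_zero fun h0 => hne (m - (j + 1)) (by omega) (by omega) ?_
          rw [← hmod, h0, Nat.zero_mod]
        exact h1.trans (hdec _ hpos (hlt _)).le
    refine .inr ⟨h, ?_, ?_, hsnd⟩
    · obtain ⟨c, hc⟩ := hdvd
      have hd : minimalPeriod F 0 ∣ 2 * m := IsPeriodicPt.minimalPeriod_dvd h2m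
      have hFm : F^[minimalPeriod F 0] 0 = 0 := iterate_minimalPeriod
      have hc2 : c ≤ 2 := by
        have := Nat.le_of_dvd (by omega) hd
        rw [hc] at this
        by_contra h
        nlinarith
      interval_cases c
      · rw [hc] at hd; simp at hd; omega
      · rw [hc, mul_one, h] at hFm; omega
      · rw [hc, mul_comm]
    · intro i hi him
      have h1 := hfst (m - i) (by omega)
      rw [Nat.sub_sub_self him] at h1
      rw [← hmod, Nat.mod_eq_sub_mod h1, Nat.mod_eq_of_lt (by have := hlt i; omega)]
      omega

/-! ### Finite tables: rows as orbits, passage from size 2^n to 2^(n+1) -/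

/-- The value of `p * q` computed in the table of size `2 ^ n`. -/
def tab (n p q : ℕ) : ℕ := 2 ^ n - star (2 ^ n) (2 ^ n - p) (2 ^ n - q)

theorem tab_zero_left {n q : ℕ} (hq : q ≤ 2 ^ n) : tab n 0 q = q := by
  rw [tab, Nat.sub_zero, star_self]; omega

theorem tab_last {n p : ℕ} (hp : 0 < p) (hpn : p ≤ 2 ^ n) : tab n p (2 ^ n - 1) = p - 1 := by
  rw [tab, Nat.sub_sub_self Nat.one_le_two_pow, star_one (by omega)]; omega

theorem tab_lt {n p : ℕ} (q : ℕ) (hp : 0 < p) (hpn : p ≤ 2 ^ n) : tab n p q < p := by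
  have := lt_star (N := 2 ^ n) (p := 2 ^ n - p) (by omega) (2 ^ n - q)
  rw [tab]; omega

theorem tab_pred {n p q : ℕ} (hp : 0 < p) (hpn : p ≤ 2 ^ n) (hq : q + 1 < 2 ^ n) :
    tab n p q = tab n (tab n p (q + 1)) (p - 1) := by
  have hlt : 2 ^ n - p < 2 ^ n := by omega
  have h := star_succ (N := 2 ^ n) (p := 2 ^ n - p) (q := 2 ^ n - (q + 1)) hlt (by omega)
  have h2 := (lt_star hlt (2 ^ n - (q + 1))).2
  unfold tab
  rw [Nat.sub_sub_self h2, show 2 ^ n - (p - 1) = 2 ^ n - p + 1 by omega, ← h]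
  congr 2; omega

theorem tab_iterate_lt {n p : ℕ} (hp : 0 < p) (hpn : p ≤ 2 ^ n) (i : ℕ) :
    (fun x => tab n x (p - 1))^[i] 0 < p :=
  iterate_zero_lt (by simp only [tab_zero_left (n := n) (q := p - 1) (by omega)]; omega)
    (fun _ h0 hx => tab_lt _ h0 (by omega)) i

/-- A row of the table, read backwards, is an orbit of `x ↦ x * (p - 1)`. -/
theorem tab_sub_eq_iterate {n p i : ℕ} (hp : 0 < p) (hpn : p ≤ 2 ^ n) (hi : 0 < i)
    (hin : i ≤ 2 ^ n) : tab n p (2 ^ n - i) = (fun x => tab n x (p - 1))^[i] 0 := by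
  induction i, hi using Nat.le_induction with
  | base => rw [tab_last hp hpn]; exact (tab_zero_left (by omega)).symm
  | succ i hi ih =>
    rw [iterate_succ_apply', ← ih (by omega), tab_pred hp hpn (by omega)]
    congr 2; omega

/-- The row index 2^n corresponds to `star N 0`, outside {1, …, N}. It is admitted because it
behaves like its residue 0. -/
theorem tab_two_pow {n q : ℕ} (hq : q < 2 ^ n) : tab n (2 ^ n) q = q := by
  have h : ∀ i, 0 < i → i ≤ 2 ^ n → tab n (2 ^ n) (2 ^ n - i) = 2 ^ n - i := by
    intro i hi
    induction i, hi using Nat.le_induction with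
    | base => intro _; exact tab_last (by positivity) le_rfl
    | succ i hi ih =>
      intro hin
      rw [tab_pred (by positivity) le_rfl (by omega),
        show 2 ^ n - (i + 1) + 1 = 2 ^ n - i by omega, ih (by omega),
        tab_last (by omega) (by omega)]
      omega
  have := h (2 ^ n - q) (by omega) (by omega)
  rwa [Nat.sub_sub_self hq.le] at this

/-- Column q of the double table is reached after 2N - q backward steps; modulo N this is the step
count for column q % N of the smaller table. -/
theorem dvd_mod_add_sub {N q : ℕ} (hq : q < 2 * N) : N ∣ q % N + (2 * N - q) := by
  have h := Nat.mod_add_div q N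
  have h2 : q / N < 2 := Nat.div_lt_of_lt_mul (by omega)
  interval_cases h3 : q / N
  · exact ⟨2, by omega⟩
  · exact ⟨1, by omega⟩

/-- The vanishing of column 0, `hZ`, closes the orbit up. It remains a hypothesis until
`tab_zero_right` proves it by induction on n. -/
theorem tab_isPeriodicPt {n : ℕ} (hZ : ∀ p, 0 < p → p ≤ 2 ^ n → tab n p 0 = 0)
    {p : ℕ} (hp : 0 < p) (hpn : p ≤ 2 ^ n) :
    IsPeriodicPt (fun x => tab n x (p - 1)) (2 ^ n) 0 := by
  rw [IsPeriodicPt, IsFixedPt, ← tab_sub_eq_iterate hp hpn (by positivity) le_rfl, Nat.sub_self,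
    hZ p hp hpn]

theorem tab_eq_iterate {n : ℕ} (hZ : ∀ p, 0 < p → p ≤ 2 ^ n → tab n p 0 = 0)
    {p q i : ℕ} (hp : 0 < p) (hpn : p ≤ 2 ^ n) (hq : q < 2 ^ n)
    (hi : 2 ^ n ∣ q + i) : tab n p q = (fun x => tab n x (p - 1))^[i] 0 := by
  have hper := tab_isPeriodicPt hZ hp hpn
  have h := tab_sub_eq_iterate (i := 2 ^ n - q) hp hpn (by omega) (by omega)
  rw [Nat.sub_sub_self hq.le] at h
  rw [h, ← hper.iterate_mod_apply (2 ^ n - q), ← hper.iterate_mod_apply i]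
  have : 2 ^ n - q + q ≡ i + q [MOD 2 ^ n] := by
    rw [Nat.sub_add_cancel hq.le]
    exact ((Nat.modEq_zero_iff_dvd.2 dvd_rfl).trans
      (Nat.modEq_zero_iff_dvd.2 (by rwa [add_comm])).symm)
  rw [show (2 ^ n - q) % 2 ^ n = i % 2 ^ n from Nat.ModEq.add_right_cancel' q this]

/-- The rows of index at most `2 ^ n` in the next table are obtained by repetition. -/
theorem tab_succ_low {n : ℕ} (hZ : ∀ p, 0 < p → p ≤ 2 ^ n → tab n p 0 = 0)
    {p q : ℕ} (hp : 0 < p) (hpn : p ≤ 2 ^ n) (hq : q < 2 ^ (n + 1)) :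
    tab (n + 1) p q = tab n p (q % 2 ^ n) := by
  have h2 : 2 ^ (n + 1) = 2 * 2 ^ n := pow_succ' 2 n
  induction p using Nat.strong_induction_on generalizing q with
  | _ p ih =>
    have h := tab_sub_eq_iterate (n := n + 1) (i := 2 ^ (n + 1) - q) hp (by omega) (by omega)
      (by omega)
    rw [Nat.sub_sub_self hq.le] at h
    rw [h, tab_eq_iterate hZ (i := 2 ^ (n + 1) - q) hp hpn (Nat.mod_lt _ (by positivity))
      (h2 ▸ dvd_mod_add_sub (h2 ▸ hq))]
    generalize 2 ^ (n + 1) - q = i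
    induction i with
    | zero => rfl
    | succ i ihi =>
      rw [iterate_succ_apply', iterate_succ_apply', ihi]
      have hlt := tab_iterate_lt hp hpn i
      generalize (fun x => tab n x (p - 1))^[i] 0 = x at hlt
      rcases Nat.eq_zero_or_pos x with rfl | hx
      · simp only [tab_zero_left (n := n) (q := p - 1) (by omega),
          tab_zero_left (n := n + 1) (q := p - 1) (by omega)]
      · simp only [ih x hlt hx (by omega) (q := p - 1) (by omega)]
        rw [Nat.mod_eq_of_lt (by omega)]

theorem tab_succ_iterate_mod {n : ℕ} {p : ℕ} (hp : 0 < p) (hpn : p ≤ 2 ^ n)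
    (ih : ∀ x < 2 ^ n + p, ∀ q < 2 ^ (n + 1),
      tab (n + 1) x q % 2 ^ n = tab n (x % 2 ^ n) (q % 2 ^ n)) (i : ℕ) :
    (fun x => tab (n + 1) x (2 ^ n + p - 1))^[i] 0 % 2 ^ n = (fun x => tab n x (p - 1))^[i] 0 := by
  have h2 : 2 ^ (n + 1) = 2 * 2 ^ n := pow_succ' 2 n
  induction i with
  | zero => simp
  | succ i ihi =>
    rw [iterate_succ_apply', iterate_succ_apply',
      ih _ (tab_iterate_lt (by omega) (by omega) i) _ (by omega), ihi]
    congr 1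
    rw [Nat.add_sub_assoc hp, Nat.add_mod_left, Nat.mod_eq_of_lt (by omega)]

/-- Reduction modulo `2 ^ n` is a homomorphism from the next table. -/
theorem tab_succ_mod {n : ℕ} (hZ : ∀ p, 0 < p → p ≤ 2 ^ n → tab n p 0 = 0)
    {p q : ℕ} (hpn : p ≤ 2 ^ (n + 1)) (hq : q < 2 ^ (n + 1)) :
    tab (n + 1) p q % 2 ^ n = tab n (p % 2 ^ n) (q % 2 ^ n) := by
  have h2 : 2 ^ (n + 1) = 2 * 2 ^ n := pow_succ' 2 n
  have hqm : q % 2 ^ n < 2 ^ n := Nat.mod_lt _ (by positivity)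
  induction p using Nat.strong_induction_on generalizing q with
  | _ p ih =>
    rcases Nat.eq_zero_or_pos p with rfl | hp
    · rw [tab_zero_left hq.le, Nat.zero_mod, tab_zero_left hqm.le]
    rcases lt_trichotomy p (2 ^ n) with h | rfl | h
    · rw [tab_succ_low hZ hp h.le hq, Nat.mod_eq_of_lt h,
        Nat.mod_eq_of_lt ((tab_lt _ hp h.le).trans h)]
    · rw [tab_succ_low hZ hp le_rfl hq, Nat.mod_self, tab_two_pow hqm, tab_zero_left hqm.le,
        Nat.mod_mod]
    · obtain ⟨p, rfl⟩ := Nat.exists_eq_add_of_lt h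
      have h3 := tab_sub_eq_iterate (n := n + 1) (i := 2 ^ (n + 1) - q) hp (by omega) (by omega)
        (by omega)
      rw [Nat.sub_sub_self hq.le] at h3
      have h4 := tab_succ_iterate_mod (p := p + 1) (by omega) (by omega)
        (fun x hx q hq => ih x (by omega) (by omega) hq (Nat.mod_lt _ (by positivity)))
        (2 ^ (n + 1) - q)
      rw [h3, add_assoc, h4, ← tab_eq_iterate hZ (q := q % 2 ^ n) (by omega) (by omega) hqm
        (h2 ▸ dvd_mod_add_sub (h2 ▸ hq)), Nat.add_mod_left]
      rcases eq_or_ne (p + 1) (2 ^ n) with h5 | h5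
      · rw [h5, Nat.mod_self, tab_two_pow hqm, tab_zero_left hqm.le]
      · rw [Nat.mod_eq_of_lt (a := p + 1) (by omega)]

/-- The old orbit period divides 2^n and a lift at most doubles it, so the new orbit is back at 0
after 2^(n+1) steps. -/
theorem tab_succ_zero_right {n : ℕ} (hZ : ∀ p, 0 < p → p ≤ 2 ^ n → tab n p 0 = 0)
    {p : ℕ} (hp : 0 < p) (hpn : p ≤ 2 ^ (n + 1)) :
    tab (n + 1) p 0 = 0 := by
  have h2 : 2 ^ (n + 1) = 2 * 2 ^ n := pow_succ' 2 n
  have hN : 0 < 2 ^ n := by positivity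
  rcases le_or_gt p (2 ^ n) with h | h
  · rw [tab_succ_low hZ hp h (by positivity), Nat.zero_mod, hZ p hp h]
  · obtain ⟨p, rfl⟩ := Nat.exists_eq_add_of_lt h
    have hmod : (2 ^ n + p) % 2 ^ n = p := by
      rw [Nat.add_mod_left, Nat.mod_eq_of_lt (by omega)]
    have hper := tab_isPeriodicPt hZ (p := p + 1) (by omega) (by omega)
    have h5 := minimalPeriod_lift (F := fun x => tab (n + 1) x (2 ^ n + (p + 1) - 1))
      (f := fun x => tab n x (p + 1 - 1)) hN
      (hper.minimalPeriod_pos hN)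
      (tab_succ_iterate_mod (by omega) (by omega)
        fun x hx q hq => tab_succ_mod hZ (by omega) hq)
      (by
        change tab (n + 1) (2 ^ n) (2 ^ n + p) = tab n 0 p
        rw [tab_succ_low hZ hN le_rfl (by omega), hmod, tab_two_pow (by omega),
          tab_zero_left (by omega)])
      (by
        intro x hx hxn
        change tab (n + 1) x (2 ^ n + p) = tab n x p
        rw [tab_succ_low hZ hx hxn.le (by omega), hmod])
      (fun x hx hxn => tab_lt _ hx (by omega))
      (by
        change tab (n + 1) 0 (2 ^ n + p) < _
        rw [tab_zero_left (by omega)]; omega)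
    have h6 := tab_sub_eq_iterate (n := n + 1) (p := 2 ^ n + (p + 1)) (i := 2 ^ (n + 1)) hp hpn
      (by positivity) le_rfl
    rw [Nat.sub_self] at h6
    rw [add_assoc, h6]
    have h7 : minimalPeriod (fun x => tab n x (p + 1 - 1)) 0 ∣ 2 ^ n := hper.minimalPeriod_dvd
    refine isPeriodicPt_iff_minimalPeriod_dvd.2 ?_
    rcases h5 with h | h
    · rw [h.2, h2]; exact h7.mul_left 2
    · rw [h.2.1, h2]; exact mul_dvd_mul_left 2 h7

theorem tab_zero_right (n : ℕ) : ∀ p, 0 < p → p ≤ 2 ^ n → tab n p 0 = 0 := by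
  induction n with
  | zero =>
    intro p hp hpn
    have := tab_lt 0 hp hpn
    simp at hpn
    omega
  | succ n ih => exact fun p => tab_succ_zero_right ih

theorem tab_lt_two_pow {n p q : ℕ} (hp : p < 2 ^ n) (hq : q < 2 ^ n) : tab n p q < 2 ^ n := by
  rcases Nat.eq_zero_or_pos p with rfl | h
  · rwa [tab_zero_left hq.le]
  · exact (tab_lt _ h hp.le).trans hp

theorem tab_eq_of_le {m n p q : ℕ} (hmn : m ≤ n) (hp : p < 2 ^ m) (hq : q < 2 ^ m) :
    tab n p q = tab m p q := by
  induction n, hmn using Nat.le_induction with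
  | base => rfl
  | succ n hmn ih =>
    have h := Nat.pow_le_pow_right two_pos hmn
    have h2 := Nat.pow_le_pow_right two_pos n.le_succ
    rcases Nat.eq_zero_or_pos p with rfl | h0
    · rw [tab_zero_left (by omega), tab_zero_left (by omega)]
    · rw [tab_succ_low (tab_zero_right n) h0 (by omega) (by omega), Nat.mod_eq_of_lt (by omega), ih]

theorem tab_mod {m n p q : ℕ} (hmn : m ≤ n) (hp : p < 2 ^ n) (hq : q < 2 ^ n) :
    tab n p q % 2 ^ m = tab m (p % 2 ^ m) (q % 2 ^ m) := by
  induction n, hmn using Nat.le_induction generalizing p q with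
  | base =>
    rw [Nat.mod_eq_of_lt (tab_lt_two_pow hp hq), Nat.mod_eq_of_lt hp, Nat.mod_eq_of_lt hq]
  | succ n hmn ih =>
    have hd : 2 ^ m ∣ 2 ^ n := pow_dvd_pow 2 hmn
    rw [← Nat.mod_mod_of_dvd _ hd, tab_succ_mod (tab_zero_right n) hp.le hq,
      ih (Nat.mod_lt _ (by positivity)) (Nat.mod_lt _ (by positivity)),
      Nat.mod_mod_of_dvd _ hd, Nat.mod_mod_of_dvd _ hd]

/-! ### The operation on all of ℕ and left distributivity -/

/-- `p * q` may be computed in any table that is large enough. -/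
theorem op_eq_tab {n p q : ℕ} (hp : p < 2 ^ n) (hq : q < 2 ^ n) : op p q = tab n p q := by
  have h : (max p q).size ≤ n := Nat.size_le.2 (max_lt hp hq)
  have h2 := Nat.lt_size_self (max p q)
  exact (tab_eq_of_le h ((le_max_left _ _).trans_lt h2) ((le_max_right _ _).trans_lt h2)).symm

theorem exists_lt_two_pow (a b : ℕ) : ∃ n, a < 2 ^ n ∧ b < 2 ^ n :=
  ⟨a + b, (Nat.lt_two_pow_self).trans_le (Nat.pow_le_pow_right two_pos (by omega)),
    (Nat.lt_two_pow_self).trans_le (Nat.pow_le_pow_right two_pos (by omega))⟩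

theorem op_zero_left (q : ℕ) : op 0 q = q := by
  obtain ⟨n, hn, hq⟩ := exists_lt_two_pow 0 q
  rw [op_eq_tab hn hq, tab_zero_left hq.le]

theorem op_lt {p : ℕ} (q : ℕ) (hp : 0 < p) : op p q < p := by
  obtain ⟨n, hpn, hq⟩ := exists_lt_two_pow p q
  rw [op_eq_tab hpn hq]; exact tab_lt _ hp hpn.le

theorem op_zero_right (p : ℕ) : op p 0 = 0 := by
  rcases Nat.eq_zero_or_pos p with rfl | hp
  · exact op_zero_left 0
  obtain ⟨n, hpn, hq⟩ := exists_lt_two_pow p 0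
  rw [op_eq_tab hpn hq, tab_zero_right n p hp hpn.le]

theorem op_pred {p : ℕ} (q : ℕ) (hp : 0 < p) : op p q = op (op p (q + 1)) (p - 1) := by
  obtain ⟨n, hpn, hq⟩ := exists_lt_two_pow p (q + 1)
  have h := tab_lt (n := n) (q + 1) hp hpn.le
  rw [op_eq_tab hpn (by omega), op_eq_tab hpn hq, op_eq_tab (n := n) (by omega) (by omega),
    tab_pred hp hpn.le hq]

theorem op_mod (n p q : ℕ) : op p q % 2 ^ n = op (p % 2 ^ n) (q % 2 ^ n) := by
  obtain ⟨m, hp, hq⟩ := exists_lt_two_pow p q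
  have h := Nat.pow_le_pow_right two_pos (le_max_left m n)
  rw [op_eq_tab (n := max m n) (by omega) (by omega), tab_mod (le_max_right _ _) (by omega)
    (by omega), op_eq_tab (Nat.mod_lt _ (by positivity)) (Nat.mod_lt _ (by positivity))]

theorem op_two_pow (n q : ℕ) : op (2 ^ n) q = q % 2 ^ n := by
  have h := op_mod n (2 ^ n) q
  rwa [Nat.mod_eq_of_lt (op_lt _ (by positivity)), Nat.mod_self, op_zero_left] at h

theorem op_mod_right {n p : ℕ} (q : ℕ) (hp : 0 < p) (hpn : p ≤ 2 ^ n) :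
    op p (q % 2 ^ n) = op p q := by
  rw [← Nat.mod_eq_of_lt ((op_lt q hp).trans_le hpn),
    ← Nat.mod_eq_of_lt ((op_lt (q % 2 ^ n) hp).trans_le hpn), op_mod, op_mod n p q, Nat.mod_mod]

theorem op_last {n p : ℕ} (hp : 0 < p) (hpn : p ≤ 2 ^ n) : op p (2 ^ n - 1) = p - 1 := by
  rcases hpn.lt_or_eq with h | rfl
  · rw [op_eq_tab h (by omega), tab_last hp hpn]
  · rw [op_two_pow, Nat.mod_eq_of_lt (by omega)]

/-- Left distributivity. -/
theorem op_op (a b c : ℕ) : op a (op b c) = op (op a b) (op a c) := by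
  induction a using Nat.strong_induction_on generalizing b c with
  | _ a iha =>
    rcases Nat.eq_zero_or_pos a with rfl | ha
    · simp only [op_zero_left]
    induction b using Nat.strong_induction_on generalizing c with
    | _ b ihb =>
      rcases Nat.eq_zero_or_pos b with rfl | hb
      · simp only [op_zero_left, op_zero_right]
      obtain ⟨n, h1, h2⟩ := exists_lt_two_pow (max a b) c
      have han : a < 2 ^ n := (le_max_left _ _).trans_lt h1
      have hbn : b < 2 ^ n := (le_max_right _ _).trans_lt h1
      -- Descending induction on the third argument c: `op_pred` expands b * c and a * c, and the
      -- outer hypotheses apply to b * (c + 1) < b and a * b < a.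
      have key : ∀ i < 2 ^ n, op a (op b (2 ^ n - 1 - i)) = op (op a b) (op a (2 ^ n - 1 - i)) := by
        intro i
        induction i with
        | zero =>
          intro _
          rw [Nat.sub_zero, op_last hb hbn.le, op_last ha han.le, op_pred _ ha,
            Nat.sub_add_cancel hb]
        | succ i ih =>
          intro hi
          have h3 : 2 ^ n - 1 - (i + 1) + 1 = 2 ^ n - 1 - i := by omega
          rw [op_pred _ hb, op_pred (2 ^ n - 1 - (i + 1)) ha, h3, ihb _ (op_lt _ hb),
            ih (by omega), op_pred (b - 1) ha, Nat.sub_add_cancel hb, ← iha _ (op_lt _ ha)]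
      have := key (2 ^ n - 1 - c) (by omega)
      rwa [Nat.sub_sub_self (by omega)] at this

/-! ### Periods of rows -/

/-- The period of the orbit of `0` under `x ↦ x * (p - 1)`, which is the row of `p` read
backwards. -/
noncomputable def orbitPeriod (p : ℕ) : ℕ := minimalPeriod (fun x => op x (p - 1)) 0

theorem op_two_pow_sub {n p i : ℕ} (hp : 0 < p) (hpn : p ≤ 2 ^ n) (hi : i ≤ 2 ^ n) :
    op p (2 ^ n - i) = (fun x => op x (p - 1))^[i] 0 := by
  induction i with
  | zero => rw [Nat.sub_zero, ← op_mod_right _ hp hpn, Nat.mod_self, op_zero_right]; rfl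
  | succ i ih =>
    rw [iterate_succ_apply', ← ih (by omega), op_pred _ hp]
    congr 2; omega

theorem isPeriodicPt_two_pow {n p : ℕ} (hp : 0 < p) (hpn : p ≤ 2 ^ n) :
    IsPeriodicPt (fun x => op x (p - 1)) (2 ^ n) 0 := by
  rw [IsPeriodicPt, IsFixedPt, ← op_two_pow_sub hp hpn le_rfl, Nat.sub_self, op_zero_right]

theorem orbitPeriod_dvd {n p : ℕ} (hp : 0 < p) (hpn : p ≤ 2 ^ n) : orbitPeriod p ∣ 2 ^ n :=
  (isPeriodicPt_two_pow hp hpn).minimalPeriod_dvd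

theorem orbitPeriod_pos {p : ℕ} (hp : 0 < p) : 0 < orbitPeriod p :=
  (isPeriodicPt_two_pow hp Nat.lt_two_pow_self.le).minimalPeriod_pos (by positivity)

theorem op_eq_iterate {p q i : ℕ} (hp : 0 < p) (hi : orbitPeriod p ∣ q + i) :
    op p q = (fun x => op x (p - 1))^[i] 0 := by
  obtain ⟨n, hpn, hq⟩ := exists_lt_two_pow p q
  have h := op_two_pow_sub (i := 2 ^ n - q) hp hpn.le (by omega)
  rw [Nat.sub_sub_self hq.le] at h
  have h2 : 2 ^ n - q + q ≡ i + q [MOD orbitPeriod p] := by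
    rw [Nat.sub_add_cancel hq.le]
    exact (Nat.modEq_zero_iff_dvd.2 (orbitPeriod_dvd hp hpn.le)).trans
      (Nat.modEq_zero_iff_dvd.2 (by rwa [add_comm])).symm
  rw [h, ← iterate_mod_minimalPeriod_eq, ← iterate_mod_minimalPeriod_eq (n := i)]
  rw [show (2 ^ n - q) % minimalPeriod (fun x => op x (p - 1)) 0 = _ from
    Nat.ModEq.add_right_cancel' q h2]

theorem op_eq_zero_iff {p q : ℕ} (hp : 0 < p) : op p q = 0 ↔ orbitPeriod p ∣ q := by
  obtain ⟨n, hpn, hq⟩ := exists_lt_two_pow p q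
  have h := op_two_pow_sub (i := 2 ^ n - q) hp hpn.le (by omega)
  rw [Nat.sub_sub_self hq.le] at h
  rw [h, ← Nat.dvd_sub_iff_right hq.le (orbitPeriod_dvd hp hpn.le)]
  exact isPeriodicPt_iff_minimalPeriod_dvd

theorem op_periodic {p : ℕ} (hp : 0 < p) : Periodic (op p) (orbitPeriod p) := by
  intro q
  have h : orbitPeriod p ∣ q + (orbitPeriod p * q - q) := by
    rw [Nat.add_sub_cancel' (Nat.le_mul_of_pos_left q (orbitPeriod_pos hp))]
    exact dvd_mul_right _ _
  rw [op_eq_iterate hp h, op_eq_iterate hp]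
  rw [add_right_comm]
  exact h.add dvd_rfl

theorem period_eq_orbitPeriod {p : ℕ} (hp : 0 < p) : period p = orbitPeriod p := by
  refine le_antisymm (Nat.sInf_le ⟨orbitPeriod_pos hp, op_periodic hp⟩) ?_
  refine le_csInf ⟨_, orbitPeriod_pos hp, op_periodic hp⟩ ?_
  rintro t ⟨ht, h⟩
  refine Nat.le_of_dvd ht ((op_eq_zero_iff hp).1 ?_)
  have := h 0
  rwa [zero_add, op_zero_right] at this

/-- `∘` turns composition of rows into a row. -/
theorem comp_op {p q : ℕ} (r : ℕ) (hq : 0 < q) : op (comp p q) r = op p (op q r) := by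
  have hc : 0 < comp p q := Nat.succ_pos _
  obtain ⟨n, h1, hr⟩ := exists_lt_two_pow (max (comp p q) q) r
  have h2 := op_two_pow_sub (i := 2 ^ n - r) hc ((le_max_left _ _).trans h1.le) (by omega)
  have h3 := op_two_pow_sub (i := 2 ^ n - r) hq ((le_max_right _ _).trans h1.le) (by omega)
  rw [Nat.sub_sub_self hr.le] at h2 h3
  rw [h2, h3]
  generalize 2 ^ n - r = i
  induction i with
  | zero => exact (op_zero_right p).symm
  | succ i ih =>
    -- By left distributivity `op p` carries x ↦ x * (q - 1) to x ↦ x * (p * (q - 1)), and p * (q -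
    -- 1) = p ∘ q - 1.
    rw [iterate_succ_apply', iterate_succ_apply', ih, op_op]
    rfl

/-- Structure of the row of `2 ^ n + p` in terms of the row of `p`. -/
theorem orbitPeriod_two_pow_add {n p : ℕ} (hp : 0 < p) (hpn : p ≤ 2 ^ n) :
    orbitPeriod (2 ^ n + p) = orbitPeriod p ∨
    (orbitPeriod (2 ^ n + p) = 2 * orbitPeriod p ∧
      (∀ q < orbitPeriod p, op (2 ^ n + p) q = op p q) ∧
      ∀ q < orbitPeriod p, op (2 ^ n + p) (q + orbitPeriod p) = op p q + 2 ^ n) := by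
  have hN : 0 < 2 ^ n := by positivity
  have hmod : (2 ^ n + p - 1) % 2 ^ n = p - 1 := by
    rw [Nat.add_sub_assoc hp, Nat.add_mod_left, Nat.mod_eq_of_lt (by omega)]
  have hlt : ∀ i, (fun x => op x (p - 1))^[i] 0 < p :=
    iterate_zero_lt (by simp only [op_zero_left]; omega) fun x hx _ => op_lt _ hx
  have h5 := minimalPeriod_lift (F := fun x => op x (2 ^ n + p - 1))
    (f := fun x => op x (p - 1)) hN (orbitPeriod_pos hp)
    (by
      intro i
      induction i with
      | zero => simp
      | succ i ih =>
        rw [iterate_succ_apply', op_mod, hmod, ih]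
        rw [← iterate_succ_apply' (fun x => op x (p - 1))])
    (by simp only [op_two_pow, hmod, op_zero_left])
    (by
      intro x hx hxn
      simp only [← op_mod_right (2 ^ n + p - 1) hx hxn.le, hmod])
    (fun x hx _ => op_lt _ hx)
    (by simp only [op_zero_left]; omega)
  rcases h5 with h | ⟨-, h1, h2, h3⟩
  · exact .inl h.2
  · refine .inr ⟨h1, fun q hq => ?_, fun q hq => ?_⟩
    · rw [op_eq_iterate hp (i := orbitPeriod p - q) (by rw [Nat.add_sub_cancel' hq.le]),
        ← h3 (orbitPeriod p - q) (by omega) (Nat.sub_le _ _)]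
      refine op_eq_iterate (by omega) ?_
      change minimalPeriod _ _ ∣ _
      rw [h1]
      change 2 * orbitPeriod p ∣ q + (orbitPeriod p + (orbitPeriod p - q))
      exact ⟨1, by omega⟩
    · rw [op_eq_iterate hp (i := orbitPeriod p - q) (by rw [Nat.add_sub_cancel' hq.le]),
        add_comm _ (2 ^ n), ← h2 (orbitPeriod p - q) (by omega) (Nat.sub_le _ _)]
      refine op_eq_iterate (by omega) ?_
      change minimalPeriod _ _ ∣ _
      rw [h1]
      change 2 * orbitPeriod p ∣ q + orbitPeriod p + (orbitPeriod p - q)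
      exact ⟨1, by omega⟩

/-! ### Counting binary digits -/

theorem bit_two_mul (x : ℕ) : bit (2 * x) = bit x := by
  rcases Nat.eq_zero_or_pos x with rfl | hx
  · rfl
  · simp [bit, Nat.digits_def' one_lt_two (show 0 < 2 * x by omega)]

theorem bit_two_mul_add_one (x : ℕ) : bit (2 * x + 1) = bit x + 1 := by
  simp only [bit, Nat.digits_def' one_lt_two (show 0 < 2 * x + 1 by omega)]
  rw [show (2 * x + 1) % 2 = 1 by omega, show (2 * x + 1) / 2 = x by omega, List.count_cons_self]

theorem bit_add_two_pow {a x : ℕ} (hx : x < 2 ^ a) : bit (x + 2 ^ a) = bit x + 1 := by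
  induction a generalizing x with
  | zero =>
    obtain rfl : x = 0 := by simpa using hx
    exact bit_two_mul_add_one 0
  | succ a ih =>
    rw [pow_succ'] at hx ⊢
    obtain ⟨y, rfl | rfl⟩ : ∃ y, x = 2 * y ∨ x = 2 * y + 1 := ⟨x / 2, by omega⟩
    · rw [← mul_add, bit_two_mul, bit_two_mul, ih (by omega)]
    · rw [show 2 * y + 1 + 2 * 2 ^ a = 2 * (y + 2 ^ a) + 1 by ring, bit_two_mul_add_one,
        bit_two_mul_add_one, ih (by omega)]

theorem bit_le {a x : ℕ} (hx : x < 2 ^ a) : bit x ≤ a := by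
  induction a generalizing x with
  | zero =>
    obtain rfl : x = 0 := by simpa using hx
    exact le_rfl
  | succ a ih =>
    rw [pow_succ'] at hx
    obtain ⟨y, rfl | rfl⟩ : ∃ y, x = 2 * y ∨ x = 2 * y + 1 := ⟨x / 2, by omega⟩
    · rw [bit_two_mul]; exact (ih (by omega)).trans a.le_succ
    · rw [bit_two_mul_add_one]; exact Nat.succ_le_succ (ih (by omega))

theorem bit_lt {a x : ℕ} (hx : x + 1 < 2 ^ a) : bit x < a := by
  induction a generalizing x with
  | zero => simp at hx
  | succ a ih =>
    rw [pow_succ'] at hx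
    obtain ⟨y, rfl | rfl⟩ : ∃ y, x = 2 * y ∨ x = 2 * y + 1 := ⟨x / 2, by omega⟩
    · rw [bit_two_mul]; exact Nat.lt_succ_iff.2 (bit_le (by omega))
    · rw [bit_two_mul_add_one]; exact Nat.succ_lt_succ (ih (by omega))

theorem bit_two_pow_sub_one (a : ℕ) : bit (2 ^ a - 1) = a := by
  induction a with
  | zero => rfl
  | succ a ih =>
    have h : 0 < 2 ^ a := by positivity
    rw [show 2 ^ (a + 1) - 1 = 2 ^ a - 1 + 2 ^ a by rw [pow_succ']; omega,
      bit_add_two_pow (by omega), ih]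

theorem bit_two_pow_add_sub_one {n p : ℕ} (hp : 0 < p) (hpn : p ≤ 2 ^ n) :
    bit (2 ^ n + p - 1) = bit (p - 1) + 1 := by
  rw [← bit_add_two_pow (a := n) (by omega)]
  congr 1; omega

/-! ### Maximal numbers, built digit by digit -/

/-- Every number `p ≥ 2` is `2 ^ n` plus a number in `{1, …, 2 ^ n}`; this gives an induction
principle. -/
theorem two_pow_add_induction {motive : ℕ → Prop} (one : motive 1)
    (add : ∀ n p, 0 < p → p ≤ 2 ^ n → motive p → motive (2 ^ n + p)) {p : ℕ} (hp : 0 < p) :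
    motive p := by
  induction p using Nat.strong_induction_on with
  | _ p ih =>
    rcases Nat.lt_or_ge 1 p with h | h
    · have h1 := Nat.pow_log_le_self 2 (show p - 1 ≠ 0 by omega)
      have h2 := Nat.lt_pow_succ_log_self one_lt_two (p - 1)
      rw [pow_succ'] at h2
      have h3 : 0 < 2 ^ Nat.log 2 (p - 1) := by positivity
      have := add (Nat.log 2 (p - 1)) (p - 2 ^ Nat.log 2 (p - 1)) (by omega) (by omega)
        (ih _ (by omega) (by omega))
      rwa [Nat.add_sub_cancel' (by omega)] at this
    · obtain rfl : p = 1 := by omega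
      exact one

theorem orbitPeriod_one : orbitPeriod 1 = 1 :=
  Nat.dvd_one.1 (orbitPeriod_dvd (n := 0) one_pos le_rfl)

theorem orbitPeriod_le {p : ℕ} (hp : 0 < p) : orbitPeriod p ≤ 2 ^ bit (p - 1) := by
  refine two_pow_add_induction (motive := fun p => orbitPeriod p ≤ 2 ^ bit (p - 1)) ?_ ?_ hp
  · rw [orbitPeriod_one]; exact Nat.one_le_two_pow
  · intro n p hp hpn ih
    rw [bit_two_pow_add_sub_one hp hpn, pow_succ']
    rcases orbitPeriod_two_pow_add hp hpn with h | h
    · omega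
    · have := h.1; omega

theorem isMaximal_iff {p : ℕ} : IsMaximal p ↔ 0 < p ∧ orbitPeriod p = 2 ^ bit (p - 1) :=
  and_congr_right fun hp => by rw [period_eq_orbitPeriod hp]

theorem IsMaximal.orbitPeriod_eq {p : ℕ} (h : IsMaximal p) : orbitPeriod p = 2 ^ bit (p - 1) :=
  (isMaximal_iff.1 h).2

/-- The bound `orbitPeriod_le` can be attained only if the period doubles at every digit. -/
theorem isMaximal_two_pow_add {n p : ℕ} (hp : 0 < p) (hpn : p ≤ 2 ^ n) :
    IsMaximal (2 ^ n + p) ↔ IsMaximal p ∧ orbitPeriod (2 ^ n + p) ≠ orbitPeriod p := by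
  rw [isMaximal_iff, isMaximal_iff, bit_two_pow_add_sub_one hp hpn, pow_succ']
  have h1 := orbitPeriod_le hp
  have h2 := orbitPeriod_pos hp
  rcases orbitPeriod_two_pow_add hp hpn with h | ⟨h, -⟩ <;> omega

theorem isMaximal_two_pow (n : ℕ) : IsMaximal (2 ^ n) := by
  have h : 0 < 2 ^ n := by positivity
  refine isMaximal_iff.2 ⟨h, ?_⟩
  rw [bit_two_pow_sub_one]
  refine Nat.dvd_antisymm (orbitPeriod_dvd h le_rfl) ?_
  have := (op_eq_zero_iff (q := orbitPeriod (2 ^ n)) h).2 dvd_rfl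
  rw [op_two_pow] at this
  exact Nat.dvd_of_mod_eq_zero this

theorem IsMaximal.induction {motive : ℕ → Prop} (one : motive 1)
    (add : ∀ n p, p ≤ 2 ^ n → IsMaximal p → IsMaximal (2 ^ n + p) → motive p → motive (2 ^ n + p))
    {p : ℕ} (hp : IsMaximal p) : motive p := by
  refine two_pow_add_induction (motive := fun p => IsMaximal p → motive p) (fun _ => one)
    (fun n p h0 hpn ih h => ?_) hp.1 hp
  have h1 := ((isMaximal_two_pow_add h0 hpn).1 h).1
  exact add n p hpn h1 h (ih h1)

/-! ### Rows of maximal numbers and closure -/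

/-- The row of a maximal number is additive in the binary digits of the argument. -/
theorem IsMaximal.exists_row {p : ℕ} (hp : IsMaximal p) : ∃ P : ℕ → ℕ,
    ∀ a < bit (p - 1), ∀ x < 2 ^ a, op p x < 2 ^ P a ∧ op p (x + 2 ^ a) = op p x + 2 ^ P a := by
  refine hp.induction (motive := fun p => ∃ P : ℕ → ℕ, ∀ a < bit (p - 1), ∀ x < 2 ^ a,
    op p x < 2 ^ P a ∧ op p (x + 2 ^ a) = op p x + 2 ^ P a) ?_ ?_
  · exact ⟨id, fun a ha => absurd ha (Nat.not_lt_zero a)⟩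
  · rintro n p hpn h1 h2 ⟨P, hP⟩
    have h3 := ((isMaximal_two_pow_add h1.1 hpn).1 h2).2
    obtain ⟨-, h4, h5⟩ := (orbitPeriod_two_pow_add h1.1 hpn).resolve_left h3
    rw [h1.orbitPeriod_eq] at h4 h5
    -- The second half of the new row is the first half shifted by 2^n, so the new digit position
    -- bit(p - 1) is sent to n.
    refine ⟨update P (bit (p - 1)) n, fun a ha x hx => ?_⟩
    rw [bit_two_pow_add_sub_one h1.1 hpn] at ha
    rcases (Nat.lt_succ_iff.1 ha).lt_or_eq with h | rfl
    · have h6 : 2 * 2 ^ a ≤ 2 ^ bit (p - 1) := by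
        rw [← pow_succ']; exact Nat.pow_le_pow_right two_pos h
      rw [update_of_ne h.ne, h4 x (by omega), h4 (x + 2 ^ a) (by omega)]
      exact hP a h x hx
    · rw [update_self, h4 x hx, h5 x hx]
      exact ⟨(op_lt _ h1.1).trans_le hpn, rfl⟩

/-- Dropping leading binary digits of q - 1 preserves maximality. -/
theorem IsMaximal.exists_modEq {q : ℕ} (hq : IsMaximal q) (k : ℕ) :
    ∃ r, IsMaximal r ∧ r ≤ 2 ^ k ∧ (q - 1) % 2 ^ k = (r - 1) % 2 ^ k := by
  refine hq.induction (motive := fun q => ∃ r, IsMaximal r ∧ r ≤ 2 ^ k ∧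
    (q - 1) % 2 ^ k = (r - 1) % 2 ^ k) ?_ ?_
  · exact ⟨1, isMaximal_two_pow 0, Nat.one_le_two_pow, rfl⟩
  · rintro n q hqn h1 h2 ⟨r, hr, hrk, h⟩
    rcases le_or_gt (2 ^ n + q) (2 ^ k) with h3 | h3
    · exact ⟨_, h2, h3, rfl⟩
    · refine ⟨r, hr, hrk, ?_⟩
      have hkn : k ≤ n := by
        by_contra hc
        have := Nat.pow_le_pow_right two_pos (show n + 1 ≤ k by omega)
        rw [pow_succ'] at this
        omega
      obtain ⟨c, hc⟩ := pow_dvd_pow 2 hkn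
      rw [Nat.add_sub_assoc h1.1, hc, Nat.mul_add_mod, h]

theorem IsMaximal.op_mod {p : ℕ} (hp : IsMaximal p) (x : ℕ) :
    op p (x % 2 ^ bit (p - 1)) = op p x := by
  rw [← hp.orbitPeriod_eq]
  exact (op_periodic hp.1).map_mod_nat x

theorem IsMaximal.bit_op {p x : ℕ} (hp : IsMaximal p) (hx : x < 2 ^ bit (p - 1)) :
    bit (op p x) = bit x := by
  obtain ⟨P, hP⟩ := hp.exists_row
  have key : ∀ a ≤ bit (p - 1), ∀ x < 2 ^ a, bit (op p x) = bit x := by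
    intro a
    induction a with
    | zero =>
      intro _ x hx
      obtain rfl : x = 0 := by simpa using hx
      rw [op_zero_right]
    | succ a ih =>
      intro ha x hx
      rcases lt_or_ge x (2 ^ a) with h | h
      · exact ih (by omega) x h
      · obtain ⟨y, rfl⟩ := Nat.exists_eq_add_of_le' h
        have hy : y < 2 ^ a := by rw [pow_succ'] at hx; omega
        obtain ⟨h1, h2⟩ := hP a ha y hy
        rw [h2, bit_add_two_pow h1, bit_add_two_pow hy, ih (by omega) y hy]
  exact key _ le_rfl x hx

theorem IsMaximal.comp {p q : ℕ} (hp : IsMaximal p) (hq : IsMaximal q) :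
    IsMaximal (comp p q) := by
  obtain ⟨r, hr, hrk, h⟩ := hq.exists_modEq (bit (p - 1))
  have hc : Laver.comp p q = Laver.comp p r := by
    rw [Laver.comp, Laver.comp, ← hp.op_mod (q - 1), h, hp.op_mod]
  have hr0 := hr.1
  rw [hc]
  refine isMaximal_iff.2 ⟨Nat.succ_pos _, ?_⟩
  rw [show Laver.comp p r - 1 = op p (r - 1) from rfl, hp.bit_op (by omega), ← hr.orbitPeriod_eq]
  -- The values r * x lie below r ≤ 2^bit(p - 1), the period of p, so p * (r * x) vanishes only if r
  -- * x does.
  have key : ∀ x, orbitPeriod (Laver.comp p r) ∣ x ↔ orbitPeriod r ∣ x := by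
    intro x
    rw [← op_eq_zero_iff (p := Laver.comp p r) (Nat.succ_pos _), ← op_eq_zero_iff hr0, comp_op x hr0,
      op_eq_zero_iff hp.1, hp.orbitPeriod_eq]
    exact ⟨fun h => Nat.eq_zero_of_dvd_of_lt h ((op_lt x hr0).trans_le hrk), fun h => h ▸ dvd_zero _⟩
  exact Nat.dvd_antisymm ((key _).2 dvd_rfl) ((key _).1 dvd_rfl)

theorem IsMaximal.op {p q : ℕ} (hp : IsMaximal p) (hq : IsMaximal q) :
    IsMaximal (op p q) ∨ Laver.op p q = 0 := by
  obtain ⟨P, hP⟩ := hp.exists_row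
  have hpow : ∀ a < bit (p - 1), Laver.op p (2 ^ a) = 2 ^ P a := fun a ha => by
    simpa [op_zero_right] using (hP a ha 0 (by positivity)).2
  have hmono : ∀ a, a + 1 < bit (p - 1) → P a < P (a + 1) := fun a ha => by
    have := (hP (a + 1) ha (2 ^ a) (Nat.pow_lt_pow_right one_lt_two a.lt_succ_self)).1
    rw [hpow a (by omega)] at this
    exact (Nat.pow_lt_pow_iff_right one_lt_two).1 this
  have hpow' : ∀ a, IsMaximal (Laver.op p (2 ^ a)) ∨ Laver.op p (2 ^ a) = 0 := fun a => by
    rcases lt_or_ge a (bit (p - 1)) with ha | ha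
    · rw [hpow a ha]; exact .inl (isMaximal_two_pow _)
    · refine .inr ((op_eq_zero_iff hp.1).2 ?_)
      rw [hp.orbitPeriod_eq]; exact pow_dvd_pow 2 ha
  -- This bounds the period of p * q by 2^P(bit(q - 1)). A new digit raises the left side by one and
  -- the right side by at least one, since P is strictly increasing.
  have hbit : ∀ q, 0 < q → q < 2 ^ bit (p - 1) →
      0 < Laver.op p q ∧ bit (q - 1) < bit (p - 1) ∧
        bit (Laver.op p q - 1) ≤ P (bit (q - 1)) := by
    intro q hq
    have hbase : ∀ a, 2 ^ a < 2 ^ bit (p - 1) → 0 < Laver.op p (2 ^ a) ∧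
        bit (2 ^ a - 1) < bit (p - 1) ∧
        bit (Laver.op p (2 ^ a) - 1) ≤ P (bit (2 ^ a - 1)) := fun a ha => by
      have ha := (Nat.pow_lt_pow_iff_right one_lt_two).1 ha
      rw [hpow a ha, bit_two_pow_sub_one, bit_two_pow_sub_one]
      exact ⟨by positivity, ha, le_rfl⟩
    refine two_pow_add_induction (motive := fun q => q < 2 ^ bit (p - 1) →
      0 < Laver.op p q ∧ bit (q - 1) < bit (p - 1) ∧
        bit (Laver.op p q - 1) ≤ P (bit (q - 1))) (hbase 0) ?_ hq
    intro a q hq hqa ih hlt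
    rcases hqa.lt_or_eq with h | rfl
    · have ha : a < bit (p - 1) := (Nat.pow_lt_pow_iff_right one_lt_two).1 (by omega)
      obtain ⟨h0, h1, h2⟩ := ih (by omega)
      obtain ⟨h3, h4⟩ := hP a ha q h
      have h5 : bit (q - 1) + 1 < bit (p - 1) := by
        have := bit_lt (a := a) (x := q - 1) (by omega)
        omega
      rw [bit_two_pow_add_sub_one hq hqa, add_comm (2 ^ a) q, h4, add_comm,
        bit_two_pow_add_sub_one h0 h3.le]
      exact ⟨by positivity, h5, (Nat.succ_le_succ h2).trans (hmono _ h5)⟩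
    · rw [← two_mul, ← pow_succ'] at hlt ⊢
      exact hbase _ hlt
  refine hq.induction (motive := fun q => IsMaximal (Laver.op p q) ∨ Laver.op p q = 0)
    (hpow' 0) ?_
  intro a q hqa hq hq' ih
  rcases hqa.lt_or_eq with h | rfl
  swap
  · rw [← two_mul, ← pow_succ']; exact hpow' _
  rcases le_or_gt (bit (p - 1)) a with ha | ha
  -- The new digit of q is a multiple of the period of p, hence invisible to its row.
  · obtain ⟨c, hc⟩ := pow_dvd_pow 2 ha
    rwa [← hp.op_mod, hc, Nat.mul_add_mod, hp.op_mod]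
  have h0 := hq.1
  have hak : 2 ^ a < 2 ^ bit (p - 1) := Nat.pow_lt_pow_right one_lt_two ha
  obtain ⟨h1, h2, h3⟩ := hbit q h0 (by omega)
  obtain ⟨h4, h5⟩ := hP a ha q h
  have hs := ih.resolve_right h1.ne'
  -- 2^bit(q - 1) is the period of q, where the shifted second half of the row of 2^a + q begins.
  have hrow : Laver.op (2 ^ a + q) (2 ^ bit (q - 1)) = 2 ^ a := by
    have h6 := (isMaximal_two_pow_add h0 hqa).1 hq'
    have h7 := ((orbitPeriod_two_pow_add h0 hqa).resolve_left h6.2).2.2 0 (orbitPeriod_pos h0)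
    rwa [zero_add, op_zero_right, zero_add, hq.orbitPeriod_eq] at h7
  have hLD := op_op p (2 ^ a + q) (2 ^ bit (q - 1))
  rw [hrow, hpow a ha, hpow _ h2, add_comm (2 ^ a) q, h5, add_comm _ (2 ^ P a)] at hLD
  rw [add_comm (2 ^ a) q, h5, add_comm]
  refine .inl ((isMaximal_two_pow_add h1 h4.le).2 ⟨hs, fun hper => ?_⟩)
  -- Without doubling, the period would still be 2^bit(p * q - 1), which divides 2^P(bit(q - 1));
  -- but `hLD` gives the value 2^(P a) ≠ 0 there.
  have h8 : Laver.op (2 ^ P a + Laver.op p q) (2 ^ P (bit (q - 1))) = 0 := by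
    rw [op_eq_zero_iff (by omega), hper, hs.orbitPeriod_eq]
    exact pow_dvd_pow 2 h3
  rw [h8] at hLD
  exact absurd hLD (by positivity)

end Laver

theorem mainTheorem3 :
    (∀ p q : ℕ, p ∈ Laver.maximalSetStar → q ∈ Laver.maximalSetStar →
      Laver.op p q ∈ Laver.maximalSetStar) ∧
    (∀ p q : ℕ, p ∈ Laver.maximalSet → q ∈ Laver.maximalSet →
      Laver.comp p q ∈ Laver.maximalSet) := by
  refine ⟨fun p q hp hq => ?_, fun p q hp hq => Laver.IsMaximal.comp hp hq⟩
  rcases hp with hp | rfl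
  · rcases hq with hq | rfl
    · exact Laver.IsMaximal.op hp hq
    · exact .inr (Laver.op_zero_right p)
  · rwa [Laver.op_zero_left]
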